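/- Let $(\Omega,\mathcal F,\mathbb P)$ be a nonatomic probability space, i.e. every $A\in\mathcal F$ with $\mathbb P(A)>0$ contains some $B\in\mathcal F$ with $0<\mathbb P(B)<\mathbb P(A)$; random variables that coincide almost surely are identified. Let $u:\mathbb R\to\mathbb R$ be a utility function, i.e. a nonconstant, concave and (not necessarily strictly) increasing function, and put $\widehat u(x):=u(0)-u(-|x|)$, which is an Orlicz function. Let $$H^{\widehat u}:=\{X \text{ a random variable}\,;\ \mathbb E[\widehat u(cX)]<\infty\ \text{for every } c>0\}$$ be the corresponding Orlicz heart, equipped with the Luxemburg norm $\|X\|_{\widehat u}:=\inf\{\lambda>0\,;\ \mathbb E[\widehat u(X/\lambda)]\le 1\}$ and with the almost sure order. Fix $\alpha\in\mathbb R$ such that $\alpha\le u(x)$ for some $x\in\mathbb R$, and set $$\mathcal A_u:=\{X\in H^{\widehat u}\,;\ \mathbb E[u(X)]\ge\alpha\}.$$ Let $S=(S_0,S_T)$ be a traded asset, i.e. $S_0\in\mathbb R$ with $S_0>0$ and $S_T\in H^{\widehat u}$ is nonzero with $S_T\ge 0$ almost surely, and define $\rho_{\mathcal A_u,S}:H^{\widehat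 u}\to\mathbb R\cup\{\infty,-\infty\}$ by $$\rho_{\mathcal A_u,S}(X):=\inf\Big\{m\in\mathbb R\,;\ X+\frac{m}{S_0}S_T\in\mathcal A_u\Big\},\qquad \inf\emptyset:=\infty .$$ (i) If $u$ is bounded from above, the following statements are equivalent: (a) $\rho_{\mathcal A_u,S}$ is finitely valued, i.e. it takes neither of the values $\infty$ and $-\infty$; (b) $u(x_0)>\alpha$ for some $x_0>0$, and $\mathbb P(S_T=0)=0$. In this case, $\rho_{\mathcal A_u,S}$ is continuous on $H^{\widehat u}$. (ii) If $u$ is not bounded from above, then $\rho_{\mathcal A_u,S}$ is always finitely valued and continuous on $H^{\widehat u}$. -/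

import Mathlib

open MeasureTheory

/-- A measure is nonatomic if every measurable set of positive measure has a measurable subset of
strictly smaller positive measure. -/
def IsNonatomic {Ω : Type*} [MeasurableSpace Ω] (P : Measure Ω) : Prop :=
  ∀ A : Set Ω, MeasurableSet A → 0 < P A →
    ∃ B : Set Ω, B ⊆ A ∧ MeasurableSet B ∧ 0 < P B ∧ P B < P A

/-- A (real-valued) Orlicz function, extended to `ℝ` as an even function: convex, zero at the
origin and not identically zero. -/
structure OrliczFunction where
  toFun : ℝ → ℝ
  convex' : ConvexOn ℝ Set.univ toFun
  even' : ∀ x, toFun (-x) = toFun x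
  zero' : toFun 0 = 0
  nontrivial' : ∃ x, toFun x ≠ 0

namespace OrliczFunction

instance : CoeFun OrliczFunction (fun _ => ℝ → ℝ) := ⟨OrliczFunction.toFun⟩

variable (Φ : OrliczFunction)

theorem map_neg (x : ℝ) : Φ (-x) = Φ x := Φ.even' x

theorem map_zero : Φ 0 = 0 := Φ.zero'

theorem convex (x y : ℝ) {a b : ℝ} (ha : 0 ≤ a) (hb : 0 ≤ b) (hab : a + b = 1) :
    Φ (a * x + b * y) ≤ a * Φ x + b * Φ y := by
  simpa using Φ.convex'.2 (Set.mem_univ x) (Set.mem_univ y) ha hb hab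

theorem nonneg (x : ℝ) : 0 ≤ Φ x := by
  have h := Φ.convex x (-x) (a := 1 / 2) (b := 1 / 2) (by norm_num) (by norm_num) (by norm_num)
  have e : (1 / 2 : ℝ) * x + 1 / 2 * -x = 0 := by ring
  rw [e, Φ.map_zero, Φ.map_neg] at h
  linarith

theorem map_abs (x : ℝ) : Φ |x| = Φ x := by
  rcases abs_choice x with h | h <;> rw [h]
  exact Φ.map_neg x

theorem map_mul_le (x : ℝ) {t : ℝ} (h0 : 0 ≤ t) (h1 : t ≤ 1) : Φ (t * x) ≤ t * Φ x := by
  have h := Φ.convex x 0 h0 (sub_nonneg.2 h1) (by ring)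
  simpa [Φ.map_zero] using h

theorem continuous : Continuous Φ := by
  have h := Φ.convex'.continuousOn isOpen_univ
  exact continuousOn_univ.1 h

/-- An Orlicz function grows at least linearly. -/
theorem exists_linear_bound : ∃ a b : ℝ, 0 ≤ a ∧ 0 ≤ b ∧ ∀ x, |x| ≤ a + b * Φ x := by
  obtain ⟨z, hz⟩ := Φ.nontrivial'
  have hpos : 0 < Φ |z| := by
    rw [Φ.map_abs]; exact lt_of_le_of_ne (Φ.nonneg z) (Ne.symm hz)
  have hz0 : 0 < |z| := by
    rw [abs_pos]; rintro rfl; exact hz Φ.map_zero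
  refine ⟨|z|, |z| / Φ |z|, hz0.le, by positivity, fun x => ?_⟩
  by_cases hx : |x| ≤ |z|
  · have : 0 ≤ |z| / Φ |z| * Φ x := mul_nonneg (by positivity) (Φ.nonneg x)
    linarith
  · push Not at hx
    have hx0 : 0 < |x| := hz0.trans hx
    have h := Φ.map_mul_le |x| (t := |z| / |x|) (by positivity) ((div_le_one hx0).2 hx.le)
    rw [div_mul_cancel₀ _ hx0.ne', Φ.map_abs x] at h
    have h2 : |x| * Φ |z| ≤ |z| * Φ x := by
      have h3 := mul_le_mul_of_nonneg_left h hx0.le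
      have e : |x| * (|z| / |x| * Φ x) = |z| * Φ x := by field_simp
      linarith
    have h4 : |x| ≤ |z| / Φ |z| * Φ x := by
      rw [div_mul_eq_mul_div, le_div_iff₀ hpos]; exact h2
    linarith

end OrliczFunction

section OrliczHeart

variable {Ω : Type*} [MeasurableSpace Ω]

/-- The Orlicz heart `H^Φ`: the (classes of a.s. equal) random variables `X` such that
`E[Φ(cX)] < ∞` for every `c > 0`. -/
noncomputable def orliczHeart (Φ : OrliczFunction) (P : Measure Ω) :
    Submodule ℝ (Ω →ₘ[P] ℝ) where
  carrier := {X | ∀ c : ℝ, 0 < c → Integrable (fun ω => Φ (c * X ω)) P}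
  zero_mem' := by
    intro c _
    refine (integrable_zero Ω ℝ P).congr ?_
    filter_upwards [AEEqFun.coeFn_zero (β := ℝ) (μ := P) (α := Ω)] with ω h
    simp [h, Φ.map_zero]
  add_mem' := by
    intro X Y hX hY c hc
    have h1 := ((hX (2 * c) (by positivity)).const_mul (1 / 2)).add
      ((hY (2 * c) (by positivity)).const_mul (1 / 2))
    refine h1.mono' (Φ.continuous.comp_aestronglyMeasurable
      ((X + Y).aestronglyMeasurable.const_mul c)) ?_
    filter_upwards [AEEqFun.coeFn_add X Y] with ω h
    rw [h, Real.norm_of_nonneg (Φ.nonneg _)]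
    have h2 := Φ.convex (2 * c * X ω) (2 * c * Y ω) (a := 1 / 2) (b := 1 / 2)
      (by norm_num) (by norm_num) (by norm_num)
    have e : (1 / 2 : ℝ) * (2 * c * X ω) + 1 / 2 * (2 * c * Y ω) = c * (X ω + Y ω) := by ring
    rw [e] at h2
    exact h2
  smul_mem' := by
    intro r X hX c hc
    have key : Integrable (fun ω => Φ (c * |r| * X ω)) P := by
      by_cases hr : r = 0
      · subst hr
        simp [Φ.map_zero]
      · exact hX (c * |r|) (by positivity)
    refine key.congr ?_
    filter_upwards [AEEqFun.coeFn_smul r X] with ω h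
    have e : |c * |r| * X ω| = |c * (r • X : Ω →ₘ[P] ℝ) ω| := by
      rw [h]
      simp [abs_mul, mul_assoc]
    rw [← Φ.map_abs (c * |r| * X ω), e, Φ.map_abs]

/-- The Orlicz heart `H^Φ` as a type. -/
abbrev OrliczHeart (Φ : OrliczFunction) (P : Measure Ω) : Type _ := ↥(orliczHeart Φ P)

namespace OrliczHeart

variable {Φ : OrliczFunction} {P : Measure Ω}

/-- The scales that are admissible in the Luxemburg norm of `X`. -/
def scales (X : OrliczHeart Φ P) : Set ℝ :=
  {l : ℝ | 0 < l ∧ ∫ ω, Φ (X.1 ω / l) ∂P ≤ 1}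

/-- The Luxemburg norm `‖X‖ = inf {l > 0 ; E[Φ(X/l)] ≤ 1}`. -/
noncomputable instance : Norm (OrliczHeart Φ P) := ⟨fun X => sInf (scales X)⟩

theorem norm_def (X : OrliczHeart Φ P) : ‖X‖ = sInf (scales X) := rfl

theorem integrable_div (X : OrliczHeart Φ P) {l : ℝ} (hl : 0 < l) :
    Integrable (fun ω => Φ (X.1 ω / l)) P := by
  have h := X.2 l⁻¹ (inv_pos.2 hl)
  simpa only [div_eq_inv_mul] using h

theorem scales_nonempty (X : OrliczHeart Φ P) : (scales X).Nonempty := by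
  have h1 : Integrable (fun ω => Φ (X.1 ω)) P := by simpa using X.2 1 one_pos
  set I := ∫ ω, Φ (X.1 ω) ∂P with hI
  have hl : (0 : ℝ) < max 1 I := lt_of_lt_of_le one_pos (le_max_left _ _)
  refine ⟨max 1 I, hl, ?_⟩
  have h2 : ∫ ω, Φ (X.1 ω / max 1 I) ∂P ≤ ∫ ω, (max 1 I)⁻¹ * Φ (X.1 ω) ∂P := by
    refine integral_mono (X.integrable_div hl) (h1.const_mul _) fun ω => ?_
    have := Φ.map_mul_le (X.1 ω) (t := (max 1 I)⁻¹) (by positivity)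
      (inv_le_one_of_one_le₀ (le_max_left _ _))
    simpa only [div_eq_inv_mul] using this
  rw [integral_const_mul, ← hI] at h2
  refine h2.trans ?_
  rw [inv_mul_le_iff₀ hl, mul_one]
  exact le_max_right _ _

theorem scales_bddBelow (X : OrliczHeart Φ P) : BddBelow (scales X) :=
  ⟨0, fun _ h => h.1.le⟩

theorem scales_add {X Y : OrliczHeart Φ P} {a b : ℝ} (ha : a ∈ scales X) (hb : b ∈ scales Y) :
    a + b ∈ scales (X + Y) := by
  obtain ⟨ha0, ha⟩ := ha
  obtain ⟨hb0, hb⟩ := hb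
  have hab : 0 < a + b := add_pos ha0 hb0
  refine ⟨hab, ?_⟩
  have hi := ((X.integrable_div ha0).const_mul (a / (a + b))).add
    ((Y.integrable_div hb0).const_mul (b / (a + b)))
  have h1 : ∫ ω, Φ ((X + Y).1 ω / (a + b)) ∂P
      ≤ ∫ ω, (a / (a + b) * Φ (X.1 ω / a) + b / (a + b) * Φ (Y.1 ω / b)) ∂P := by
    refine integral_mono_ae ((X + Y).integrable_div hab) hi ?_
    filter_upwards [AEEqFun.coeFn_add X.1 Y.1] with ω h
    have e : (X + Y).1 ω / (a + b)
        = a / (a + b) * (X.1 ω / a) + b / (a + b) * (Y.1 ω / b) := by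
      rw [Submodule.coe_add, h, Pi.add_apply]
      field_simp
    rw [e]
    exact Φ.convex _ _ (by positivity) (by positivity) (by field_simp)
  rw [integral_add ((X.integrable_div ha0).const_mul _) ((Y.integrable_div hb0).const_mul _),
    integral_const_mul, integral_const_mul] at h1
  have h2 : a / (a + b) * ∫ ω, Φ (X.1 ω / a) ∂P ≤ a / (a + b) * 1 :=
    mul_le_mul_of_nonneg_left ha (by positivity)
  have h3 : b / (a + b) * ∫ ω, Φ (Y.1 ω / b) ∂P ≤ b / (a + b) * 1 :=
    mul_le_mul_of_nonneg_left hb (by positivity)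
  have e : a / (a + b) * 1 + b / (a + b) * 1 = 1 := by field_simp
  linarith

theorem scales_smul {X : OrliczHeart Φ P} {r : ℝ} (hr : r ≠ 0) {a : ℝ} (ha : a ∈ scales X) :
    |r| * a ∈ scales (r • X) := by
  have hr0 : 0 < |r| := abs_pos.2 hr
  refine ⟨mul_pos hr0 ha.1, ?_⟩
  have : ∫ ω, Φ ((r • X).1 ω / (|r| * a)) ∂P = ∫ ω, Φ (X.1 ω / a) ∂P := by
    refine integral_congr_ae ?_
    filter_upwards [AEEqFun.coeFn_smul r X.1] with ω h
    rw [Submodule.coe_smul, h, ← Φ.map_abs, ← Φ.map_abs (X.1 ω / a)]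
    congr 1
    simp only [Pi.smul_apply, smul_eq_mul, abs_div, abs_mul, abs_abs]
    field_simp
  rw [this]
  exact ha.2

theorem norm_zero' : ‖(0 : OrliczHeart Φ P)‖ = 0 := by
  refine le_antisymm ?_ (Real.sInf_nonneg fun _ h => h.1.le)
  refine le_of_forall_pos_le_add fun ε hε => ?_
  rw [zero_add]
  refine csInf_le (scales_bddBelow _) ⟨hε, ?_⟩
  have : ∫ ω, Φ ((0 : OrliczHeart Φ P).1 ω / ε) ∂P = 0 := by
    refine integral_eq_zero_of_ae ?_
    filter_upwards [AEEqFun.coeFn_zero (β := ℝ) (μ := P) (α := Ω)] with ω h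
    rw [Submodule.coe_zero, h]
    simp [Φ.map_zero]
  rw [this]
  exact zero_le_one

theorem norm_smul_le' (r : ℝ) (X : OrliczHeart Φ P) : ‖r • X‖ ≤ |r| * ‖X‖ := by
  by_cases hr : r = 0
  · subst hr
    rw [zero_smul, norm_zero', abs_zero, zero_mul]
  · have hr0 : 0 < |r| := abs_pos.2 hr
    rw [← div_le_iff₀' hr0]
    refine le_csInf (scales_nonempty X) fun a ha => ?_
    rw [div_le_iff₀' hr0]
    exact csInf_le (scales_bddBelow _) (scales_smul hr ha)

theorem norm_smul_eq (r : ℝ) (X : OrliczHeart Φ P) : ‖r • X‖ = |r| * ‖X‖ := by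
  refine le_antisymm (norm_smul_le' r X) ?_
  by_cases hr : r = 0
  · subst hr
    rw [zero_smul, norm_zero', abs_zero, zero_mul]
  · have hr0 : 0 < |r| := abs_pos.2 hr
    have h := norm_smul_le' r⁻¹ (r • X)
    rw [inv_smul_smul₀ hr, abs_inv] at h
    calc |r| * ‖X‖ ≤ |r| * (|r|⁻¹ * ‖r • X‖) := mul_le_mul_of_nonneg_left h hr0.le
      _ = ‖r • X‖ := by rw [mul_inv_cancel_left₀ hr0.ne']

theorem norm_add_le' (X Y : OrliczHeart Φ P) : ‖X + Y‖ ≤ ‖X‖ + ‖Y‖ := by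
  refine le_of_forall_pos_le_add fun ε hε => ?_
  obtain ⟨a, ha, ha'⟩ := exists_lt_of_csInf_lt (scales_nonempty X)
    (show sInf (scales X) < ‖X‖ + ε / 2 by rw [norm_def]; linarith)
  obtain ⟨b, hb, hb'⟩ := exists_lt_of_csInf_lt (scales_nonempty Y)
    (show sInf (scales Y) < ‖Y‖ + ε / 2 by rw [norm_def]; linarith)
  have := csInf_le (scales_bddBelow _) (scales_add ha hb)
  rw [norm_def (X + Y)]
  linarith

theorem eq_zero_of_norm_eq_zero [IsFiniteMeasure P] (X : OrliczHeart Φ P) (h : ‖X‖ = 0) :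
    X = 0 := by
  obtain ⟨a, b, ha, hb, hab⟩ := Φ.exists_linear_bound
  have h1 : Integrable (fun ω => Φ (X.1 ω)) P := by simpa using X.2 1 one_pos
  have hX : Integrable (fun ω => |X.1 ω|) P := by
    refine ((integrable_const a).add (h1.const_mul b)).mono'
      (continuous_abs.comp_aestronglyMeasurable X.1.aestronglyMeasurable) ?_
    refine Filter.Eventually.of_forall fun ω => ?_
    simpa using hab (X.1 ω)
  have hb1 : ∀ l ∈ scales X, ∫ ω, |X.1 ω| ∂P ≤ l * (P.real Set.univ * a + b) := by
    rintro l ⟨hl, hl1⟩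
    have h2 : ∫ ω, |X.1 ω| ∂P ≤ ∫ ω, l * (a + b * Φ (X.1 ω / l)) ∂P := by
      refine integral_mono hX (((integrable_const a).add
        ((X.integrable_div hl).const_mul b)).const_mul l) fun ω => ?_
      have h3 := mul_le_mul_of_nonneg_left (hab (X.1 ω / l)) hl.le
      rwa [abs_div, abs_of_pos hl, mul_div_cancel₀ _ hl.ne'] at h3
    rw [integral_const_mul, integral_add (integrable_const a)
      ((X.integrable_div hl).const_mul b), integral_const_mul, integral_const, smul_eq_mul] at h2
    refine h2.trans (mul_le_mul_of_nonneg_left ?_ hl.le)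
    have := mul_le_mul_of_nonneg_left hl1 hb
    linarith
  have hC : 0 ≤ P.real Set.univ * a + b := by positivity
  have h0 : ∫ ω, |X.1 ω| ∂P ≤ 0 := by
    refine le_of_forall_pos_le_add fun ε hε => ?_
    obtain ⟨l, hl, hl'⟩ := exists_lt_of_csInf_lt (scales_nonempty X)
      (show sInf (scales X) < ε / (P.real Set.univ * a + b + 1) by
        rw [← norm_def, h]; positivity)
    rw [lt_div_iff₀ (by positivity)] at hl'
    have := hb1 l hl
    have := hl.1
    linarith
  have h4 : (fun ω => |X.1 ω|) =ᵐ[P] 0 :=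
    (integral_eq_zero_iff_of_nonneg (fun ω => abs_nonneg _) hX).1
      (le_antisymm h0 (integral_nonneg fun ω => abs_nonneg _))
  refine Subtype.ext (AEEqFun.ext ?_)
  filter_upwards [h4, AEEqFun.coeFn_zero (β := ℝ) (μ := P) (α := Ω)] with ω h5 h6
  rw [Submodule.coe_zero, h6]
  simpa using h5

theorem normCore [IsFiniteMeasure P] : NormedSpace.Core ℝ (OrliczHeart Φ P) where
  norm_nonneg _ := Real.sInf_nonneg fun _ h => h.1.le
  norm_smul r X := norm_smul_eq r X
  norm_triangle X Y := norm_add_le' X Y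
  norm_eq_zero_iff X := ⟨eq_zero_of_norm_eq_zero X, fun h => by rw [h]; exact norm_zero'⟩

/-- The Orlicz heart with its Luxemburg norm, and the topology of that norm. -/
noncomputable instance [IsFiniteMeasure P] : NormedAddCommGroup (OrliczHeart Φ P) :=
  NormedAddCommGroup.ofCore normCore

noncomputable instance [IsFiniteMeasure P] : NormedSpace ℝ (OrliczHeart Φ P) :=
  NormedSpace.ofCore normCore

end OrliczHeart

end OrliczHeart

/-- A utility function: nonconstant, concave and (weakly) increasing. -/
structure UtilityFunction where
  toFun : ℝ → ℝ
  concave' : ConcaveOn ℝ Set.univ toFun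
  monotone' : Monotone toFun
  nonconstant' : ∃ x y, toFun x ≠ toFun y

namespace UtilityFunction

instance : CoeFun UtilityFunction (fun _ => ℝ → ℝ) := ⟨UtilityFunction.toFun⟩

/-- The Orlicz function `û(x) = u(0) - u(-|x|)` of a utility function `u`. -/
def hat (u : UtilityFunction) : OrliczFunction where
  toFun x := u 0 - u (-|x|)
  convex' := by
    refine ⟨convex_univ, fun x _ y _ a b ha hb hab => ?_⟩
    have h1 := u.concave'.2 (Set.mem_univ (-|x|)) (Set.mem_univ (-|y|)) ha hb hab
    have h2 : u (a • (-|x|) + b • (-|y|)) ≤ u (-|a • x + b • y|) := by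
      refine u.monotone' ?_
      have := abs_add_le (a * x) (b * y)
      rw [abs_mul, abs_mul, abs_of_nonneg ha, abs_of_nonneg hb] at this
      simp only [smul_eq_mul]
      linarith
    have e : a * u 0 + b * u 0 = u 0 := by rw [← add_mul, hab, one_mul]
    simp only [smul_eq_mul] at *
    linarith
  even' x := by simp
  zero' := by simp
  nontrivial' := by
    by_contra! hcon
    have hneg : ∀ t, t ≤ 0 → u t = u 0 := fun t ht => by
      have := hcon t
      rw [abs_of_nonpos ht, neg_neg] at this
      linarith
    have hpos : ∀ t, 0 < t → u t = u 0 := fun t ht => by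
      refine le_antisymm ?_ (u.monotone' ht.le)
      have h1 := u.concave'.2 (Set.mem_univ t) (Set.mem_univ (-t))
        (show (0 : ℝ) ≤ 1 / 2 by norm_num) (show (0 : ℝ) ≤ 1 / 2 by norm_num) (by norm_num)
      have e : (1 / 2 : ℝ) • t + (1 / 2 : ℝ) • (-t) = 0 := by simp
      rw [e, hneg (-t) (by linarith)] at h1
      simp only [smul_eq_mul] at h1
      linarith
    obtain ⟨x, y, hxy⟩ := u.nonconstant'
    have hall : ∀ t, u t = u 0 := fun t => (le_or_gt t 0).elim (hneg t) (hpos t)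
    exact hxy ((hall x).trans (hall y).symm)

end UtilityFunction

/-- A traded asset `S = (S₀, S_T)`: a price `S₀ > 0` and a nonzero payoff `S_T` in the positive
cone of the ordered vector space of financial positions. -/
structure TradedAsset (𝓧 : Type*) [AddCommGroup 𝓧] [PartialOrder 𝓧] where
  price : ℝ
  payoff : 𝓧
  price_pos : 0 < price
  payoff_nonneg : 0 ≤ payoff
  payoff_ne_zero : payoff ≠ 0

/-- The risk measure `ρ_{A,S}(X) = inf {m ∈ ℝ ; X + (m / S₀) S_T ∈ A}`, with values in the
extended real numbers (`inf ∅ = ∞`). -/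
noncomputable def riskMeasure {𝓧 : Type*} [AddCommGroup 𝓧] [Module ℝ 𝓧] [PartialOrder 𝓧]
    (A : Set 𝓧) (S : TradedAsset 𝓧) (X : 𝓧) : EReal :=
  sInf ((fun m : ℝ => (m : EReal)) '' {m : ℝ | X + (m / S.price) • S.payoff ∈ A})

/-- `ρ` takes neither of the values `∞` and `-∞`. -/
def FinitelyValued {𝓧 : Type*} (ρ : 𝓧 → EReal) : Prop :=
  ∀ X, ρ X ≠ ⊤ ∧ ρ X ≠ ⊥

/-- The acceptance set `A_u = {X ∈ H^û ; E[u(X)] ≥ α}`. The expectation is a Bochner integral: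
`u(X)` is integrable for each `X` in the Orlicz heart `H^û`, see `integrable_utility`. -/
def shortfallAcceptanceSet {Ω : Type*} [MeasurableSpace Ω] (P : Measure Ω)
    (u : UtilityFunction) (α : ℝ) : Set (OrliczHeart u.hat P) :=
  {X | α ≤ ∫ ω, u (X.1 ω) ∂P}

/-- The expectation in the definition of `A_u` never takes a junk value. -/
theorem integrable_utility {Ω : Type*} [MeasurableSpace Ω] (P : Measure Ω) [IsFiniteMeasure P]
    (u : UtilityFunction) (X : OrliczHeart u.hat P) : Integrable (fun ω => u (X.1 ω)) P := by
  have h1 : Integrable (fun ω => u.hat (X.1 ω)) P := by simpa using X.2 1 one_pos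
  have hc : Continuous u :=
    continuousOn_univ.1 (u.concave'.continuousOn isOpen_univ)
  refine ((integrable_const |u 0|).add h1).mono'
    (hc.comp_aestronglyMeasurable X.1.aestronglyMeasurable) ?_
  refine Filter.Eventually.of_forall fun ω => ?_
  set x := X.1 ω
  have e : u.hat x = u 0 - u (-|x|) := rfl
  have h2 := u.monotone' (neg_abs_le x)
  have h3 := u.monotone' (le_abs_self x)
  have h4 := u.concave'.2 (Set.mem_univ |x|) (Set.mem_univ (-|x|))
    (show (0 : ℝ) ≤ 1 / 2 by norm_num) (show (0 : ℝ) ≤ 1 / 2 by norm_num) (by norm_num)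
  have e2 : (1 / 2 : ℝ) • |x| + (1 / 2 : ℝ) • (-|x|) = 0 := by simp
  rw [e2] at h4
  simp only [smul_eq_mul] at h4
  have h5 := le_abs_self (u 0)
  have h6 := neg_abs_le (u 0)
  simp only [Pi.add_apply, Real.norm_eq_abs]
  rw [abs_le]
  constructor <;> linarith

open Filter Topology

/-! ### Finiteness and continuity of risk measures -/

section RiskMeasure

variable {𝓧 : Type*} [AddCommGroup 𝓧] [Module ℝ 𝓧] [PartialOrder 𝓧]

/-! Put `g X = E[u(X)]`. On the heart `g` is finite and concave. Since `u ≥ u 0 - û`, it is bounded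
below on the open unit ball, hence continuous; it increases along `S_T`. The value `-∞` never
occurs: `u` lies below an affine function of positive slope and `E[S_T] > 0`. Everything thus
reduces to one slack condition: for each `X` some `t` satisfies `g (X + t S_T) > α`. It gives
finiteness at once, and continuity through concavity along `S_T`
(`continuous_riskMeasure_superlevel`).

Slack holds in two situations. If `u` is bounded, exceeds `α` somewhere and `S_T > 0` a.s., then `g
(X + n S_T)` tends to `sup u > α` by dominated convergence. If `u` is unbounded, the gain on a set
where `S_T` is bounded away from zero outweighs any loss due to `X`.

Conversely, let `u` be bounded. If `S_T` vanishes with positive probability, a sufficiently negative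
constant position cannot be rescued (`exists_expectedUtility_lt_of_payoff_zero`). If `u ≤ α`
everywhere, acceptability would force `u (X + t S_T) = α` a.s. The position `X = -f (1 + S_T)`, with
`f` unbounded, defeats this for every `t`. Nonatomicity enters only here, to find such an `f` that
keeps `X` in the heart (`exists_unbounded_mul`). -/

theorem riskMeasure_ne_top_iff (A : Set 𝓧) (S : TradedAsset 𝓧) (X : 𝓧) :
    riskMeasure A S X ≠ ⊤ ↔ ∃ t : ℝ, X + t • S.payoff ∈ A := by
  rw [riskMeasure, Ne, sInf_eq_top]
  constructor
  · intro h
    push Not at h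
    obtain ⟨_, ⟨m, hm, rfl⟩, -⟩ := h
    exact ⟨_, hm⟩
  · rintro ⟨t, ht⟩ h
    refine EReal.coe_ne_top _ (h _ ⟨t * S.price, ?_, rfl⟩)
    rwa [Set.mem_ofPred_eq, mul_div_cancel_right₀ _ S.price_pos.ne']

theorem riskMeasure_ne_bot {A : Set 𝓧} {S : TradedAsset 𝓧} {X : 𝓧} {b : ℝ}
    (hb : ∀ t : ℝ, X + t • S.payoff ∈ A → b ≤ t) : riskMeasure A S X ≠ ⊥ := by
  refine ne_bot_of_le_ne_bot (EReal.coe_ne_bot (b * S.price)) (le_sInf ?_)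
  rintro _ ⟨m, hm, rfl⟩
  exact EReal.coe_le_coe_iff.2 ((le_div_iff₀ S.price_pos).1 (hb _ hm))

/-- A risk measure with respect to an upper level set of a concave continuous functional that is
monotone in the direction of the payoff is continuous, provided that every position can be made
strictly acceptable. -/
theorem continuous_riskMeasure_superlevel [TopologicalSpace 𝓧] (S : TradedAsset 𝓧) (g : 𝓧 → ℝ)
    (α : ℝ) (hcont : ∀ t : ℝ, Continuous fun X => g (X + t • S.payoff))
    (hconc : ConcaveOn ℝ Set.univ g) (hmono : ∀ X, Monotone fun t : ℝ => g (X + t • S.payoff))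
    (hslack : ∀ X, ∃ t : ℝ, α < g (X + t • S.payoff)) :
    Continuous (riskMeasure {X | α ≤ g X} S) := by
  refine continuous_iff_continuousAt.2 fun X => tendsto_order.2 ⟨fun r hr => ?_, fun r hr => ?_⟩
  · obtain ⟨q, hrq, hq⟩ := EReal.lt_iff_exists_real_btwn.1 hr
    have hlt : g (X + (q / S.price) • S.payoff) < α := by
      by_contra! h
      exact hq.not_ge (sInf_le ⟨q, h, rfl⟩)
    filter_upwards [(hcont (q / S.price)).continuousAt.eventually_lt_const hlt] with Y hY
    refine hrq.trans_le (le_sInf ?_)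
    rintro _ ⟨m, hm, rfl⟩
    refine EReal.coe_le_coe_iff.2 (le_of_not_gt fun hmq => ?_)
    have := hmono Y (div_le_div_of_nonneg_right hmq.le S.price_pos.le)
    simp only [Set.mem_ofPred_eq] at hm this
    linarith
  · obtain ⟨_, ⟨m, hm, rfl⟩, hmr⟩ := sInf_lt_iff.1 hr
    obtain ⟨q, hmq, hqr⟩ := EReal.lt_iff_exists_real_btwn.1 hmr
    have hmq' : m < q := EReal.coe_lt_coe_iff.1 hmq
    suffices hlt : α < g (X + (q / S.price) • S.payoff) by
      filter_upwards [(hcont (q / S.price)).continuousAt.eventually_const_lt hlt] with Y hY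
      exact lt_of_le_of_lt (sInf_le ⟨q, hY.le, rfl⟩) hqr
    -- The acceptable amount `m` need not be strictly acceptable, but any larger amount is: it lies
    -- beyond the slack point `t`, or strictly between `m` and `t`, where concavity gives a value
    -- above `α`.
    obtain ⟨t, ht⟩ := hslack X
    set p := m / S.price
    set s := q / S.price
    have hps : p < s := div_lt_div_of_pos_right hmq' S.price_pos
    rcases le_or_gt t s with hts | hts
    · exact ht.trans_le (hmono X hts)
    · have htp : 0 < t - p := by linarith
      have h := hconc.2 (Set.mem_univ (X + p • S.payoff)) (Set.mem_univ (X + t • S.payoff))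
        (show 0 ≤ (t - s) / (t - p) from div_nonneg (by linarith) htp.le)
        (show 0 ≤ (s - p) / (t - p) from div_nonneg (by linarith) htp.le)
        (by field_simp; ring)
      have e : ((t - s) / (t - p)) • (X + p • S.payoff) + ((s - p) / (t - p)) • (X + t • S.payoff)
          = X + s • S.payoff := by
        match_scalars <;> field_simp <;> ring
      rw [e, smul_eq_mul, smul_eq_mul] at h
      refine lt_of_lt_of_le ?_ h
      have h1 : (t - s) / (t - p) * α ≤ (t - s) / (t - p) * g (X + p • S.payoff) :=
        mul_le_mul_of_nonneg_left hm (div_nonneg (by linarith) htp.le)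
      have h2 : (s - p) / (t - p) * α < (s - p) / (t - p) * g (X + t • S.payoff) :=
        mul_lt_mul_of_pos_left ht (div_pos (by linarith) htp)
      have h3 : (t - s) / (t - p) * α + (s - p) / (t - p) * α = α := by field_simp; ring
      linarith

end RiskMeasure

/-! ### Growth of utility functions -/

namespace UtilityFunction

variable (u : UtilityFunction)

theorem continuous : Continuous u :=
  continuousOn_univ.1 (u.concave'.continuousOn isOpen_univ)

theorem le_concave (x y : ℝ) {a b : ℝ} (ha : 0 ≤ a) (hb : 0 ≤ b) (hab : a + b = 1) :
    a * u x + b * u y ≤ u (a * x + b * y) := by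
  simpa using u.concave'.2 (Set.mem_univ x) (Set.mem_univ y) ha hb hab

theorem hat_apply (x : ℝ) : u.hat x = u 0 - u (-|x|) := rfl

theorem sub_hat_le (x : ℝ) : u 0 - u.hat x ≤ u x := by
  rw [hat_apply, sub_sub_cancel]
  exact u.monotone' (neg_abs_le x)

/-- A utility function is dominated by an affine function of positive slope. -/
theorem exists_affine_bound : ∃ a b : ℝ, 0 < b ∧ ∀ x, u x ≤ a + b * x := by
  obtain ⟨p, q, hpq, hlt⟩ : ∃ p q, p < q ∧ u p < u q := by
    obtain ⟨x, y, hxy⟩ := u.nonconstant'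
    rcases lt_or_gt_of_ne hxy with h | h
    · exact ⟨x, y, u.monotone'.reflect_lt h, h⟩
    · exact ⟨y, x, u.monotone'.reflect_lt h, h⟩
  have hd : 0 < q - p := sub_pos.2 hpq
  set b := (u q - u p) / (q - p) with hbdef
  have hb : 0 < b := div_pos (sub_pos.2 hlt) hd
  have hbq : b * (q - p) = u q - u p := div_mul_cancel₀ _ hd.ne'
  -- This is the line of slope `b` through `(p, u q)`, parallel to the chord over `[p, q]`. Outside
  -- the interval `u` lies below the chord's line, which is lower still; inside, `u ≤ u q` suffices.
  refine ⟨u q - b * p, b, hb, fun x => ?_⟩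
  rcases le_or_gt x p with hx | hx
  · have h := u.le_concave x q (a := (q - p) / (q - x)) (b := (p - x) / (q - x))
      (div_nonneg hd.le (by linarith)) (div_nonneg (by linarith) (by linarith))
      (by have : q - x ≠ 0 := by linarith
          field_simp; ring)
    have hqx : 0 < q - x := by linarith
    have e : (q - p) / (q - x) * x + (p - x) / (q - x) * q = p := by field_simp; ring
    rw [e, div_mul_eq_mul_div, div_mul_eq_mul_div, ← add_div, div_le_iff₀ hqx] at h
    have h1 : (q - p) * u x ≤ (q - p) * (u p - b * (p - x)) := by
      linear_combination h + (p - x) * hbq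
    have := le_of_mul_le_mul_left h1 hd
    linarith
  rcases le_or_gt x q with hx' | hx'
  · have := u.monotone' hx'
    have := mul_pos hb (sub_pos.2 hx)
    linarith
  · have h := u.le_concave p x (a := (x - q) / (x - p)) (b := (q - p) / (x - p))
      (div_nonneg (by linarith) (by linarith)) (div_nonneg hd.le (by linarith))
      (by have : x - p ≠ 0 := by linarith
          field_simp; ring)
    have hxp : 0 < x - p := by linarith
    have e : (x - q) / (x - p) * p + (q - p) / (x - p) * x = q := by field_simp; ring
    rw [e, div_mul_eq_mul_div, div_mul_eq_mul_div, ← add_div, div_le_iff₀ hxp] at h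
    have h1 : (q - p) * u x ≤ (q - p) * (u q + b * (x - q)) := by
      linear_combination h - (x - q) * hbq
    have := le_of_mul_le_mul_left h1 hd
    linarith

theorem tendsto_atBot : Tendsto u atBot atBot := by
  obtain ⟨a, b, hb, h⟩ := u.exists_affine_bound
  exact tendsto_atBot_mono h
    (tendsto_atBot_add_const_left _ _ (tendsto_id.const_mul_atBot hb))

end UtilityFunction

/-! ### Elements of the Orlicz heart -/

namespace OrliczHeart

variable {Ω : Type*} [MeasurableSpace Ω] {P : Measure Ω}

theorem coeFn_add_smul {Φ : OrliczFunction} (X Y : OrliczHeart Φ P) (a b : ℝ) :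
    (a • X + b • Y).1 =ᵐ[P] fun ω => a * X.1 ω + b * Y.1 ω := by
  filter_upwards [AEEqFun.coeFn_add (a • X).1 (b • Y).1, AEEqFun.coeFn_smul a X.1,
    AEEqFun.coeFn_smul b Y.1] with ω h1 h2 h3
  rw [Submodule.coe_add, h1, Pi.add_apply, Submodule.coe_smul, Submodule.coe_smul, h2, h3]
  rfl

theorem coeFn_add_smul' {Φ : OrliczFunction} (X Y : OrliczHeart Φ P) (t : ℝ) :
    (X + t • Y).1 =ᵐ[P] fun ω => X.1 ω + t * Y.1 ω := by
  simpa using coeFn_add_smul X Y 1 t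

theorem integrable [IsFiniteMeasure P] {Φ : OrliczFunction} (X : OrliczHeart Φ P) :
    Integrable (fun ω => X.1 ω) P := by
  obtain ⟨a, b, ha, hb, hab⟩ := Φ.exists_linear_bound
  have h1 : Integrable (fun ω => Φ (X.1 ω)) P := by simpa using X.2 1 one_pos
  exact ((integrable_const a).add (h1.const_mul b)).mono' X.1.aestronglyMeasurable
    (Eventually.of_forall fun ω => hab (X.1 ω))

/-- A random variable whose scalings all have finite `Φ`-moments, as an element of the heart. -/
theorem exists_coeFn_eq {Φ : OrliczFunction} {f : Ω → ℝ} (hf : AEStronglyMeasurable f P)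
    (h : ∀ c : ℝ, 0 < c → Integrable (fun ω => Φ (c * f ω)) P) :
    ∃ X : OrliczHeart Φ P, X.1 =ᵐ[P] f :=
  ⟨⟨AEEqFun.mk f hf, fun c hc => (h c hc).congr <| by
    filter_upwards [AEEqFun.coeFn_mk f hf] with ω hω
    rw [hω]⟩, AEEqFun.coeFn_mk f hf⟩

theorem coeFn_nonneg {Φ : OrliczFunction} {X : OrliczHeart Φ P} (h : 0 ≤ X) :
    ∀ᵐ ω ∂P, 0 ≤ X.1 ω := by
  have h' : (0 : Ω →ₘ[P] ℝ) ≤ X.1 := h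
  filter_upwards [AEEqFun.coeFn_le.2 h', AEEqFun.coeFn_zero (β := ℝ) (μ := P) (α := Ω)]
    with ω h1 h2
  rwa [h2] at h1

theorem integral_pos [IsFiniteMeasure P] {Φ : OrliczFunction} {X : OrliczHeart Φ P} (h : 0 ≤ X)
    (h0 : X ≠ 0) : 0 < ∫ ω, X.1 ω ∂P := by
  refine lt_of_le_of_ne (integral_nonneg_of_ae (coeFn_nonneg h)) fun he => h0 ?_
  have h1 := (integral_eq_zero_iff_of_nonneg_ae (coeFn_nonneg h) X.integrable).1 he.symm
  exact Subtype.ext (AEEqFun.ext (h1.trans (AEEqFun.coeFn_zero (β := ℝ)).symm))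

theorem integral_le_one_of_norm_lt_one [IsFiniteMeasure P] {Φ : OrliczFunction}
    {X : OrliczHeart Φ P} (h : ‖X‖ < 1) : ∫ ω, Φ (X.1 ω) ∂P ≤ 1 := by
  obtain ⟨l, ⟨hl0, hl⟩, hl1⟩ := exists_lt_of_csInf_lt (scales_nonempty X)
    (show sInf (scales X) < 1 from h)
  refine le_trans (integral_mono (by simpa using X.2 1 one_pos) (X.integrable_div hl0)
    fun ω => ?_) hl
  have h1 := Φ.map_mul_le (X.1 ω / l) hl0.le hl1.le
  rw [mul_div_cancel₀ _ hl0.ne'] at h1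
  exact h1.trans (mul_le_of_le_one_left (Φ.nonneg _) hl1.le)

end OrliczHeart

/-! ### The expected utility functional -/

section ExpectedUtility

variable {Ω : Type*} [MeasurableSpace Ω] {P : Measure Ω} {u : UtilityFunction}

theorem concaveOn_expectedUtility [IsFiniteMeasure P] :
    ConcaveOn ℝ Set.univ fun X : OrliczHeart u.hat P => ∫ ω, u (X.1 ω) ∂P := by
  refine ⟨convex_univ, fun X _ Y _ a b ha hb hab => ?_⟩
  simp only [smul_eq_mul]
  rw [← integral_const_mul, ← integral_const_mul,
    ← integral_add ((integrable_utility P u X).const_mul _)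
      ((integrable_utility P u Y).const_mul _)]
  refine integral_mono_ae (((integrable_utility P u X).const_mul _).add
      ((integrable_utility P u Y).const_mul _)) (integrable_utility P u _) ?_
  filter_upwards [OrliczHeart.coeFn_add_smul X Y a b] with ω h
  rw [h]
  exact u.le_concave _ _ ha hb hab

/-- A concave function on a normed space is continuous as soon as it is bounded below near one
point. Near the origin this follows from `u ≥ u 0 - û` and `E[û(X)] ≤ 1` on the open unit ball. -/
theorem continuous_expectedUtility [IsFiniteMeasure P] :
    Continuous fun X : OrliczHeart u.hat P => ∫ ω, u (X.1 ω) ∂P := by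
  rw [← continuousOn_univ]
  have htfae := (concaveOn_expectedUtility (P := P) (u := u)).continuousOn_tfae isOpen_univ
    Set.univ_nonempty
  have hiff := htfae.out 3 1
  refine hiff.1 ⟨0, Set.mem_univ _, ∫ _, u 0 ∂P - 1, ?_⟩
  rw [eventually_map]
  filter_upwards [Metric.ball_mem_nhds (0 : OrliczHeart u.hat P) one_pos] with X hX
  have h1 := OrliczHeart.integral_le_one_of_norm_lt_one (mem_ball_zero_iff.1 hX)
  have hi : Integrable (fun ω => u.hat (X.1 ω)) P := by simpa using X.2 1 one_pos
  have h2 : ∫ ω, (u 0 - u.hat (X.1 ω)) ∂P ≤ ∫ ω, u (X.1 ω) ∂P :=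
    integral_mono ((integrable_const _).sub hi) (integrable_utility P u X)
      fun ω => u.sub_hat_le _
  rw [integral_sub (integrable_const _) hi] at h2
  change _ ≤ _
  linarith

theorem monotone_expectedUtility_add_smul [IsFiniteMeasure P] {Y : OrliczHeart u.hat P}
    (hY : 0 ≤ Y) (X : OrliczHeart u.hat P) :
    Monotone fun t : ℝ => ∫ ω, u ((X + t • Y).1 ω) ∂P := by
  intro s t hst
  refine integral_mono_ae (integrable_utility P u _) (integrable_utility P u _) ?_
  filter_upwards [OrliczHeart.coeFn_add_smul' X Y s, OrliczHeart.coeFn_add_smul' X Y t,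
    OrliczHeart.coeFn_nonneg hY] with ω h1 h2 h3
  rw [h1, h2]
  exact u.monotone' (by gcongr)

/-- Acceptability bounds the invested amount from below. -/
theorem exists_lower_bound_of_le_expectedUtility [IsFiniteMeasure P] {Y : OrliczHeart u.hat P}
    (hY : 0 ≤ Y) (hY0 : Y ≠ 0) (X : OrliczHeart u.hat P) (α : ℝ) :
    ∃ b : ℝ, ∀ t : ℝ, α ≤ ∫ ω, u ((X + t • Y).1 ω) ∂P → b ≤ t := by
  obtain ⟨a, b, hb, h⟩ := u.exists_affine_bound
  have hpos := OrliczHeart.integral_pos hY hY0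
  refine ⟨(α - ∫ ω, (a + b * X.1 ω) ∂P) / (b * ∫ ω, Y.1 ω ∂P), fun t ht => ?_⟩
  have hX : Integrable (fun ω => a + b * X.1 ω) P :=
    (integrable_const a).add (X.integrable.const_mul b)
  have hYi : Integrable (fun ω => b * t * Y.1 ω) P := Y.integrable.const_mul _
  have h1 : ∫ ω, u ((X + t • Y).1 ω) ∂P ≤ ∫ ω, ((a + b * X.1 ω) + b * t * Y.1 ω) ∂P := by
    refine integral_mono_ae (integrable_utility P u _) (hX.add hYi) ?_
    filter_upwards [OrliczHeart.coeFn_add_smul' X Y t] with ω hω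
    rw [hω]
    exact (h _).trans (le_of_eq (by ring))
  rw [integral_add hX hYi, integral_const_mul] at h1
  rw [div_le_iff₀ (mul_pos hb hpos)]
  linarith

theorem exists_lt_expectedUtility_of_bddAbove [IsProbabilityMeasure P]
    (hu : BddAbove (Set.range u)) {α x₀ : ℝ} (hx₀ : α < u x₀) {Y : OrliczHeart u.hat P}
    (hY : ∀ᵐ ω ∂P, 0 < Y.1 ω) (X : OrliczHeart u.hat P) :
    ∃ t : ℝ, α < ∫ ω, u ((X + t • Y).1 ω) ∂P := by
  obtain ⟨M, hM⟩ := hu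
  have hlim : Tendsto (fun n : ℕ => ∫ ω, u (X.1 ω + n * Y.1 ω) ∂P) atTop
      (𝓝 (∫ _, (⨆ x, u x) ∂P)) := by
    refine tendsto_integral_of_dominated_convergence (fun ω => |u (X.1 ω)| + |M|)
      (fun n => u.continuous.comp_aestronglyMeasurable
        (X.1.aestronglyMeasurable.add (Y.1.aestronglyMeasurable.const_mul _)))
      ((integrable_utility P u X).abs.add (integrable_const _)) (fun n => ?_) ?_
    · filter_upwards [hY] with ω hω
      have h1 : u (X.1 ω) ≤ u (X.1 ω + n * Y.1 ω) := u.monotone' (by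
        have : 0 ≤ (n : ℝ) * Y.1 ω := by positivity
        linarith)
      have h2 : u (X.1 ω + n * Y.1 ω) ≤ M := hM ⟨_, rfl⟩
      have := neg_abs_le (u (X.1 ω))
      have := le_abs_self M
      have := abs_nonneg (u (X.1 ω))
      have := abs_nonneg M
      rw [Real.norm_eq_abs, abs_le]
      constructor <;> linarith
    · filter_upwards [hY] with ω hω
      exact (tendsto_atTop_ciSup u.monotone' ⟨M, hM⟩).comp
        (tendsto_atTop_add_const_left _ _ (tendsto_natCast_atTop_atTop.atTop_mul_const hω))
  have hlt : α < ∫ _, (⨆ x, u x) ∂P := by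
    simpa using hx₀.trans_le (le_ciSup ⟨M, hM⟩ x₀)
  obtain ⟨n, hn⟩ := (hlim.eventually_const_lt hlt).exists
  refine ⟨n, hn.trans_eq (integral_congr_ae ?_)⟩
  filter_upwards [OrliczHeart.coeFn_add_smul' X Y n] with ω hω
  rw [hω]

/-- Concavity separates the position from the investment: `u (X + t Y) ≥ u (2 X) / 2 + u (2 t Y) /
2`. The first term has a fixed finite expectation, while the second grows without bound on a set
where `Y ≥ 1 / n`. -/
theorem exists_lt_expectedUtility_of_not_bddAbove [IsFiniteMeasure P]
    (hu : ¬ BddAbove (Set.range u)) {Y : OrliczHeart u.hat P} (hY : 0 ≤ Y) (hY0 : Y ≠ 0)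
    (X : OrliczHeart u.hat P) (α : ℝ) : ∃ t : ℝ, α < ∫ ω, u ((X + t • Y).1 ω) ∂P := by
  have hYpos := OrliczHeart.coeFn_nonneg hY
  obtain ⟨n, hn⟩ : ∃ n : ℕ, 0 < P {ω | 1 ≤ (n : ℝ) * Y.1 ω} := by
    by_contra! hcon
    have h1 : ∀ᵐ ω ∂P, ∀ n : ℕ, ¬ 1 ≤ (n : ℝ) * Y.1 ω := by
      rw [ae_all_iff]
      intro n
      rw [ae_iff]
      simpa using hcon n
    refine (OrliczHeart.integral_pos hY hY0).not_ge (integral_nonpos_of_ae ?_)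
    filter_upwards [h1] with ω hω
    by_contra! hpos
    obtain ⟨n, hn⟩ := exists_nat_ge (1 / Y.1 ω)
    exact hω n ((div_le_iff₀ hpos).1 hn)
  set A := {ω | 1 ≤ (n : ℝ) * Y.1 ω} with hA
  have hAm : MeasurableSet A :=
    measurableSet_le measurable_const (Y.1.measurable.const_mul _)
  have hAr : 0 < P.real A := ENNReal.toReal_pos hn.ne' (measure_ne_top _ _)
  set C := ∫ ω, (1 / 2 * (u 0 - u.hat (2 * X.1 ω)) + 1 / 2 * u 0) ∂P with hC
  -- The threshold makes the gain `P(A) (u x - u 0) / 2` on `A` exceed `|α - C| + 1`, where `C` is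
  -- the guaranteed expectation without that gain.
  obtain ⟨_, ⟨x, rfl⟩, hx⟩ := not_bddAbove_iff.1 hu (u 0 + 2 * ((|α - C| + 1) / P.real A))
  have hx0 : 0 < x := by
    refine u.monotone'.reflect_lt (lt_of_le_of_lt ?_ hx)
    have : 0 ≤ 2 * ((|α - C| + 1) / P.real A) := by positivity
    linarith
  refine ⟨x / 2 * n, ?_⟩
  have hi1 : Integrable (fun ω => 1 / 2 * (u 0 - u.hat (2 * X.1 ω)) + 1 / 2 * u 0) P :=
    (((integrable_const _).sub (X.2 2 two_pos)).const_mul _).add (integrable_const _)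
  have hi2 : Integrable (A.indicator fun _ => 1 / 2 * (u x - u 0)) P :=
    (integrable_const _).indicator hAm
  have h2 : ∫ ω, ((1 / 2 * (u 0 - u.hat (2 * X.1 ω)) + 1 / 2 * u 0)
      + A.indicator (fun _ => 1 / 2 * (u x - u 0)) ω) ∂P
      ≤ ∫ ω, u ((X + (x / 2 * n) • Y).1 ω) ∂P := by
    refine integral_mono_ae (hi1.add hi2) (integrable_utility P u _) ?_
    filter_upwards [OrliczHeart.coeFn_add_smul' X Y (x / 2 * n), hYpos] with ω h3 h4
    rw [h3]
    have h5 := u.le_concave (2 * X.1 ω) (x * (n * Y.1 ω)) (a := 1 / 2) (b := 1 / 2)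
      (by norm_num) (by norm_num) (by norm_num)
    have e : 1 / 2 * (2 * X.1 ω) + 1 / 2 * (x * (n * Y.1 ω)) = X.1 ω + x / 2 * n * Y.1 ω := by
      ring
    rw [e] at h5
    have h6 := u.sub_hat_le (2 * X.1 ω)
    by_cases hω : ω ∈ A
    · have h7 : u x ≤ u (x * (n * Y.1 ω)) := u.monotone' (le_mul_of_one_le_right hx0.le hω)
      simp only [Set.indicator_of_mem hω]
      linarith
    · have h7 : u 0 ≤ u (x * (n * Y.1 ω)) := u.monotone' (by positivity)
      simp only [Set.indicator_of_notMem hω]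
      linarith
  rw [integral_add hi1 hi2, integral_indicator_const _ hAm, smul_eq_mul, ← hC] at h2
  refine lt_of_lt_of_le ?_ h2
  have h8 : |α - C| + 1 < P.real A * (1 / 2 * (u x - u 0)) := by
    rw [← div_lt_iff₀' hAr]
    linarith
  have := le_abs_self (α - C)
  linarith

/-- The utility of the constant position `-k` cannot be compensated by an asset that vanishes with
positive probability if `u` is bounded from above. -/
theorem exists_expectedUtility_lt_of_payoff_zero [IsProbabilityMeasure P]
    (hu : BddAbove (Set.range u)) {Y : OrliczHeart u.hat P} (hY : P {ω | Y.1 ω = 0} ≠ 0) (α : ℝ) :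
    ∃ X : OrliczHeart u.hat P, ∀ t : ℝ, ∫ ω, u ((X + t • Y).1 ω) ∂P < α := by
  obtain ⟨M, hM⟩ := hu
  set A := {ω | Y.1 ω = 0} with hA
  have hAm : MeasurableSet A := measurableSet_eq_fun Y.1.measurable measurable_const
  have hAr : 0 < P.real A := ENNReal.toReal_pos hY (measure_ne_top _ _)
  -- On `A` the investment has no effect and elsewhere utility is at most `M`, so the expectation is
  -- at most `M + P(A) (u k - M)`; the threshold for `u k` puts this below `α`.
  obtain ⟨k, hk⟩ := (u.tendsto_atBot.eventually
    (eventually_lt_atBot (M + (α - M) / P.real A))).exists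
  obtain ⟨X, hX⟩ := OrliczHeart.exists_coeFn_eq (P := P) (Φ := u.hat) (f := fun _ => k)
    aestronglyMeasurable_const (fun c _ => integrable_const _)
  refine ⟨X, fun t => ?_⟩
  have hi : Integrable (fun ω => M + A.indicator (fun _ => u k - M) ω) P :=
    (integrable_const _).add ((integrable_const _).indicator hAm)
  have h2 : ∫ ω, u ((X + t • Y).1 ω) ∂P ≤ ∫ ω, (M + A.indicator (fun _ => u k - M) ω) ∂P := by
    refine integral_mono_ae (integrable_utility P u _) hi ?_
    filter_upwards [hX, OrliczHeart.coeFn_add_smul' X Y t] with ω h3 h4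
    rw [h4, h3]
    by_cases hω : ω ∈ A
    · have : Y.1 ω = 0 := hω
      simp [Set.indicator_of_mem hω, this]
    · simpa [Set.indicator_of_notMem hω] using hM ⟨_, rfl⟩
  rw [integral_add (integrable_const _) ((integrable_const _).indicator hAm),
    integral_indicator_const _ hAm, integral_const, smul_eq_mul, smul_eq_mul] at h2
  simp only [probReal_univ, one_mul] at h2
  have h3 : P.real A * (u k - M) < α - M := by
    rw [← lt_div_iff₀' hAr]
    linarith
  linarith

end ExpectedUtility

/-! ### Small sets in nonatomic spaces -/

/-- Repeated bisection: when a set is split into two parts of positive measure, the smaller one has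
at most half the measure. -/
theorem IsNonatomic.exists_subset_measure_lt {Ω : Type*} [MeasurableSpace Ω] {P : Measure Ω}
    [IsProbabilityMeasure P] (hP : IsNonatomic P) {A : Set Ω} (hA : MeasurableSet A)
    (hA0 : 0 < P A) {ε : ENNReal} (hε : ε ≠ 0) :
    ∃ B ⊆ A, MeasurableSet B ∧ 0 < P B ∧ P B < ε := by
  have key : ∀ n : ℕ, ∃ B ⊆ A, MeasurableSet B ∧ 0 < P B ∧ P B ≤ 2⁻¹ ^ n := by
    intro n
    induction n with
    | zero => exact ⟨A, subset_rfl, hA, hA0, by simpa using prob_le_one⟩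
    | succ n ih =>
      obtain ⟨B, hBA, hB, hB0, hBn⟩ := ih
      obtain ⟨C, hCB, hC, hC0, hCB'⟩ := hP B hB hB0
      have hsum : P C + P (B \ C) = P B := by
        rw [measure_add_sdiff hC.nullMeasurableSet, Set.union_eq_self_of_subset_left hCB]
      have hD0 : 0 < P (B \ C) := by
        rw [pos_iff_ne_zero]
        intro h
        rw [h, add_zero] at hsum
        exact hCB'.ne hsum
      have hhalf : ∀ {x y : ENNReal}, x ≤ y → x + y ≤ 2⁻¹ ^ n → x ≤ 2⁻¹ ^ (n + 1) := by
        intro x y hxy h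
        calc x = 2⁻¹ * (x + x) := by
              rw [← two_mul, ← mul_assoc, ENNReal.inv_mul_cancel two_ne_zero ENNReal.ofNat_ne_top,
                one_mul]
          _ ≤ 2⁻¹ * 2⁻¹ ^ n := by gcongr; exact (add_le_add_right hxy x).trans h
          _ = 2⁻¹ ^ (n + 1) := (pow_succ' _ _).symm
      rcases le_total (P C) (P (B \ C)) with h | h
      · exact ⟨C, hCB.trans hBA, hC, hC0, hhalf h (hsum.trans_le hBn)⟩
      · exact ⟨B \ C, Set.sdiff_subset.trans hBA, hB.diff hC, hD0,
          hhalf h ((add_comm _ _).trans_le (hsum.trans_le hBn))⟩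
  obtain ⟨n, hn⟩ := ENNReal.exists_inv_two_pow_lt hε
  obtain ⟨B, hBA, hB, hB0, hBn⟩ := key n
  exact ⟨B, hBA, hB, hB0, hBn.trans_lt hn⟩

/-- In a nonatomic space there are decreasing sets of strictly decreasing positive measure along
which prescribed integrals are as small as desired. -/
theorem IsNonatomic.exists_seq_setLIntegral_le {Ω : Type*} [MeasurableSpace Ω] {P : Measure Ω}
    [IsProbabilityMeasure P] (hP : IsNonatomic P) (h : ℕ → Ω → ENNReal)
    (hh : ∀ k, ∫⁻ ω, h k ω ∂P ≠ ⊤) {ε : ℕ → ENNReal} (hε : ∀ k, ε k ≠ 0) :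
    ∃ A : ℕ → Set Ω, Antitone A ∧ (∀ k, MeasurableSet (A k)) ∧ (∀ k, P (A (k + 1)) < P (A k)) ∧
      ∀ k, ∫⁻ ω in A (k + 1), h k ω ∂P ≤ ε k := by
  have step : ∀ (k : ℕ) (A : {A : Set Ω // MeasurableSet A ∧ 0 < P A}),
      ∃ B : {A : Set Ω // MeasurableSet A ∧ 0 < P A}, B.1 ⊆ A.1 ∧ P B.1 < P A.1 ∧
        ∫⁻ ω in B.1, h k ω ∂P ≤ ε k := by
    rintro k ⟨A, hA, hA0⟩
    -- Absolute continuity of the integral supplies `δ`; taking the minimum with `P A` below makes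
    -- the measures strictly decrease.
    obtain ⟨δ, hδ, hδ'⟩ := exists_pos_setLIntegral_lt_of_measure_lt (hh k) (hε k)
    obtain ⟨B, hBA, hB, hB0, hBδ⟩ := hP.exists_subset_measure_lt hA hA0
      (lt_min hδ hA0).ne'
    exact ⟨⟨B, hB, hB0⟩, hBA, hBδ.trans_le (min_le_right _ _),
      (hδ' B (hBδ.trans_le (min_le_left _ _))).le⟩
  choose F hF using step
  let A : ℕ → {A : Set Ω // MeasurableSet A ∧ 0 < P A} :=
    fun n => Nat.rec ⟨Set.univ, MeasurableSet.univ, by simp⟩ F n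
  exact ⟨fun n => (A n).1, antitone_nat_of_succ_le fun n => (hF n (A n)).1, fun n => (A n).2.1,
    fun n => (hF n (A n)).2.1, fun n => (hF n (A n)).2.2⟩

/-! ### Unbounded multipliers on the Orlicz heart -/

namespace OrliczHeart

variable {Ω : Type*} [MeasurableSpace Ω] {P : Measure Ω} {Φ : OrliczFunction}

theorem lintegral_lt_top (X : OrliczHeart Φ P) {c : ℝ} (hc : 0 ≤ c) :
    ∫⁻ ω, ENNReal.ofReal (Φ (c * X.1 ω)) ∂P < ⊤ := by
  rcases hc.eq_or_lt with rfl | hc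
  · simp [Φ.map_zero]
  · exact (X.2 c hc).lintegral_lt_top

/-- Over a nonatomic space, every element of an Orlicz heart can be multiplied by an unbounded
random variable without leaving the heart. -/
theorem exists_unbounded_mul [IsProbabilityMeasure P] (hP : IsNonatomic P)
    (X : OrliczHeart Φ P) :
    ∃ f : Ω → ℕ, Measurable f ∧ (∀ n, 0 < P {ω | f ω = n}) ∧
      ∀ c : ℝ, 0 < c → Integrable (fun ω => Φ (c * (f ω * X.1 ω))) P := by
  -- One factor of the square accounts for the value of `f`; the other eventually dominates any
  -- scaling `c`, so a single sequence of sets serves all `c`.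
  obtain ⟨A, hA, hAm, hAlt, hAint⟩ := hP.exists_seq_setLIntegral_le
    (fun k ω => ENNReal.ofReal (Φ (((k + 1 : ℕ) : ℝ) ^ 2 * X.1 ω)))
    (fun k => (X.lintegral_lt_top (by positivity)).ne)
    (ε := fun k => 2⁻¹ ^ (k + 1)) (fun k => by simp)
  classical
  -- The search finds the last set containing `ω`. The second alternative stops it at `0` on the
  -- intersection of all the sets, which need not be null.
  have hex : ∀ ω, ∃ k, ω ∉ A (k + 1) ∨ ω ∈ ⋂ n, A n := by
    intro ω
    by_contra! hcon
    refine (hcon 0).2 (Set.mem_iInter.2 fun n => ?_)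
    exact hA (Nat.le_succ n) (hcon n).1
  set f : Ω → ℕ := fun ω => Nat.find (hex ω) with hf
  have hfm : Measurable f := measurable_find hex fun k =>
    ((hAm (k + 1)).compl).union (MeasurableSet.iInter hAm)
  have hfA : ∀ ω, f ω ≠ 0 → ω ∈ A (f ω) := by
    intro ω hω
    obtain ⟨j, hj⟩ := Nat.exists_eq_succ_of_ne_zero hω
    have := Nat.find_min (hex ω) (m := j) (by change j < f ω; omega)
    rw [hj]
    push Not at this
    exact this.1
  refine ⟨f, hfm, fun n => ?_, fun c hc => ?_⟩
  · have hsub : A n \ A (n + 1) ⊆ {ω | f ω = n} := by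
      rintro ω ⟨h1, h2⟩
      refine (Nat.find_eq_iff (hex ω)).2 ⟨Or.inl h2, fun m hm => ?_⟩
      push Not
      exact ⟨hA (Nat.succ_le_of_lt hm) h1, fun h => h2 (Set.mem_iInter.1 h _)⟩
    refine lt_of_lt_of_le ?_ (measure_mono hsub)
    exact (tsub_pos_of_lt (hAlt n)).trans_le (le_measure_sdiff)
  · have hmeas : AEStronglyMeasurable (fun ω => Φ (c * (f ω * X.1 ω))) P :=
      Φ.continuous.comp_aestronglyMeasurable
        ((((measurable_from_top (f := fun n : ℕ => (n : ℝ))).comp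
          hfm).aestronglyMeasurable.mul X.1.aestronglyMeasurable).const_mul c)
    refine ⟨hmeas, ?_⟩
    rw [hasFiniteIntegral_iff_ofReal (Eventually.of_forall fun ω => Φ.nonneg _)]
    set g : ℕ → Ω → ENNReal := fun k ω => ENNReal.ofReal (Φ (c * k * X.1 ω)) with hg
    have hgm : ∀ k, AEMeasurable (g k) P := fun k =>
      (Φ.continuous.comp_aestronglyMeasurable
        (X.1.aestronglyMeasurable.const_mul (c * k))).aemeasurable.ennreal_ofReal
    obtain ⟨K, hK⟩ := exists_nat_ge c
    have hpt : ∀ ω, ENNReal.ofReal (Φ (c * (f ω * X.1 ω)))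
        ≤ ∑' k, (A k).indicator (g k) ω := by
      intro ω
      by_cases hω : f ω = 0
      · simp [hω, Φ.map_zero]
      · refine le_trans (le_of_eq ?_) (ENNReal.le_tsum (f ω))
        rw [Set.indicator_of_mem (hfA ω hω)]
        simp only [hg, mul_assoc]
    -- The finitely many terms with `k ≤ K` are finite because `X` is in the heart; for `k > K ≥ c`
    -- the bound `c k ≤ k ^ 2` gives a geometric tail.
    have hterm : ∀ k, ∫⁻ ω in A k, g k ω ∂P
        ≤ (if k ∈ Finset.range (K + 1) then ∫⁻ ω, g k ω ∂P else 0) + 2⁻¹ ^ k := by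
      intro k
      split_ifs with hk
      · exact (setLIntegral_le_lintegral _ _).trans le_self_add
      · rw [zero_add]
        simp only [Finset.mem_range, not_lt] at hk
        obtain ⟨j, rfl⟩ := Nat.exists_eq_succ_of_ne_zero (n := k) (by omega)
        refine le_trans (lintegral_mono fun ω => ENNReal.ofReal_le_ofReal ?_) (hAint j)
        have hKj : c ≤ ((j + 1 : ℕ) : ℝ) := hK.trans (by exact_mod_cast (by omega : K ≤ j + 1))
        have hj0 : (0 : ℝ) < ((j + 1 : ℕ) : ℝ) := by positivity
        have h1 := Φ.map_mul_le (((j + 1 : ℕ) : ℝ) ^ 2 * X.1 ω) (t := c / ((j + 1 : ℕ) : ℝ))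
          (by positivity) ((div_le_one hj0).2 hKj)
        have e : c / ((j + 1 : ℕ) : ℝ) * (((j + 1 : ℕ) : ℝ) ^ 2 * X.1 ω)
            = c * ((j + 1 : ℕ) : ℝ) * X.1 ω := by field_simp
        rw [e] at h1
        exact h1.trans (mul_le_of_le_one_left (Φ.nonneg _) ((div_le_one hj0).2 hKj))
    calc ∫⁻ ω, ENNReal.ofReal (Φ (c * (f ω * X.1 ω))) ∂P
        ≤ ∫⁻ ω, ∑' k, (A k).indicator (g k) ω ∂P := lintegral_mono hpt
      _ = ∑' k, ∫⁻ ω in A k, g k ω ∂P := by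
          rw [lintegral_tsum fun k => (hgm k).indicator (hAm k)]
          exact tsum_congr fun k => lintegral_indicator (hAm k) _
      _ ≤ ∑' k, ((if k ∈ Finset.range (K + 1) then ∫⁻ ω, g k ω ∂P else 0) + 2⁻¹ ^ k) :=
          ENNReal.tsum_le_tsum hterm
      _ = (∑ k ∈ Finset.range (K + 1), ∫⁻ ω, g k ω ∂P) + ∑' k : ℕ, 2⁻¹ ^ k := by
          rw [ENNReal.tsum_add, tsum_eq_sum (s := Finset.range (K + 1))
            (fun k hk => if_neg hk)]
          congr 1
          exact Finset.sum_congr rfl fun k hk => if_pos hk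
      _ < ⊤ := by
          refine ENNReal.add_lt_top.2 ⟨ENNReal.sum_lt_top.2 fun k _ =>
            X.lintegral_lt_top (by positivity), ?_⟩
          rw [ENNReal.tsum_geometric]
          simp

end OrliczHeart

/-! ### Necessity of strict slack, and the theorem -/

/-- If `u ≤ α`, some position in the Orlicz heart cannot be made acceptable by investing in `Y`. -/
theorem exists_expectedUtility_lt_of_le {Ω : Type*} [MeasurableSpace Ω] {P : Measure Ω}
    [IsProbabilityMeasure P] (hP : IsNonatomic P) {u : UtilityFunction} {α : ℝ}
    (hu : ∀ x, u x ≤ α) {Y : OrliczHeart u.hat P} (hY : 0 ≤ Y) :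
    ∃ X : OrliczHeart u.hat P, ∀ t : ℝ, ∫ ω, u ((X + t • Y).1 ω) ∂P < α := by
  obtain ⟨E, hE⟩ := OrliczHeart.exists_coeFn_eq (P := P) (Φ := u.hat) (f := fun _ => 1)
    aestronglyMeasurable_const (fun c _ => integrable_const _)
  obtain ⟨f, hfm, hfpos, hfint⟩ := OrliczHeart.exists_unbounded_mul hP (E + (1 : ℝ) • Y)
  obtain ⟨Z, hZ⟩ := OrliczHeart.exists_coeFn_eq (P := P) (Φ := u.hat)
    (((measurable_from_top (f := fun n : ℕ => (n : ℝ))).comp hfm).aestronglyMeasurable.mul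
      (E + (1 : ℝ) • Y).1.aestronglyMeasurable) hfint
  -- Here `Z = f (1 + Y)`. On `{f = n}` with `n ≥ t` and `n ≥ -k`, the position is worth `-n + (t -
  -- n) Y ≤ k`, where utility is below `α`.
  refine ⟨(-1 : ℝ) • Z, fun t => ?_⟩
  obtain ⟨k, hk⟩ := eventually_atBot.1 (u.tendsto_atBot.eventually (eventually_lt_atBot α))
  obtain ⟨n, hn⟩ := exists_nat_ge (max t (-k))
  have hval : ∀ᵐ ω ∂P, f ω = n → u (((-1 : ℝ) • Z + t • Y).1 ω) < α := by
    filter_upwards [hE, hZ, OrliczHeart.coeFn_add_smul' E Y 1,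
      OrliczHeart.coeFn_add_smul Z Y (-1) t, OrliczHeart.coeFn_nonneg hY]
      with ω h1 h2 h3 h4 h5 hω
    refine hk _ ?_
    rw [h4, h2]
    simp only [Pi.mul_apply, Function.comp_apply]
    rw [h3, h1, hω]
    have h6 : (t - n) * Y.1 ω ≤ 0 :=
      mul_nonpos_of_nonpos_of_nonneg (by linarith [le_max_left t (-k)]) h5
    linarith [le_max_right t (-k)]
  set V := (-1 : ℝ) • Z + t • Y
  have hi := integrable_utility P u V
  have hle : ∫ ω, u (V.1 ω) ∂P ≤ α := by
    simpa using integral_mono hi (integrable_const α) fun ω => hu _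
  -- Equality would force `u(V) = α` a.s., although `u(V) < α` on `{f = n}`, which has positive
  -- probability.
  refine lt_of_le_of_ne hle fun he => ?_
  have h0 : (fun ω => α - u (V.1 ω)) =ᵐ[P] 0 := by
    rw [← integral_eq_zero_iff_of_nonneg (fun ω => sub_nonneg.2 (hu _))
      ((integrable_const α).sub hi), integral_sub (integrable_const α) hi, he]
    simp
  refine (hfpos n).ne' ?_
  have h1 : ∀ᵐ ω ∂P, ¬ f ω = n := by
    filter_upwards [hval, h0] with ω h2 h3 h4
    have := h2 h4
    simp only [Pi.zero_apply] at h3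
    linarith
  simpa [ae_iff] using h1

theorem mainTheorem9 {Ω : Type*} [MeasurableSpace Ω] (P : Measure Ω) [IsProbabilityMeasure P]
    (hP : IsNonatomic P) (u : UtilityFunction) (α : ℝ) (hα : ∃ x₀ : ℝ, α ≤ u x₀)
    (S : TradedAsset (OrliczHeart u.hat P)) :
    (BddAbove (Set.range u) →
      (FinitelyValued (riskMeasure (shortfallAcceptanceSet P u α) S) ↔
        (∃ x₀ : ℝ, 0 < x₀ ∧ α < u x₀) ∧ P {ω | S.payoff.1 ω = 0} = 0) ∧
      (FinitelyValued (riskMeasure (shortfallAcceptanceSet P u α) S) →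
        Continuous (riskMeasure (shortfallAcceptanceSet P u α) S))) ∧
    (¬ BddAbove (Set.range u) →
      FinitelyValued (riskMeasure (shortfallAcceptanceSet P u α) S) ∧
      Continuous (riskMeasure (shortfallAcceptanceSet P u α) S)) := by
  have hslack : (∀ X : OrliczHeart u.hat P,
      ∃ t : ℝ, α < ∫ ω, u ((X + t • S.payoff).1 ω) ∂P) →
      FinitelyValued (riskMeasure (shortfallAcceptanceSet P u α) S) ∧
      Continuous (riskMeasure (shortfallAcceptanceSet P u α) S) := by
    intro h
    refine ⟨fun X => ⟨?_, ?_⟩, ?_⟩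
    · obtain ⟨t, ht⟩ := h X
      exact (riskMeasure_ne_top_iff _ _ _).2 ⟨t, ht.le⟩
    · obtain ⟨b, hb⟩ := exists_lower_bound_of_le_expectedUtility S.payoff_nonneg
        S.payoff_ne_zero X α
      exact riskMeasure_ne_bot hb
    · exact continuous_riskMeasure_superlevel S (fun X => ∫ ω, u (X.1 ω) ∂P) α
        (fun t => continuous_expectedUtility.comp (continuous_add_const _))
        concaveOn_expectedUtility (monotone_expectedUtility_add_smul S.payoff_nonneg) h
  have hbdd : BddAbove (Set.range u) →
      (∃ x₀ : ℝ, 0 < x₀ ∧ α < u x₀) ∧ P {ω | S.payoff.1 ω = 0} = 0 →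
      ∀ X : OrliczHeart u.hat P, ∃ t : ℝ, α < ∫ ω, u ((X + t • S.payoff).1 ω) ∂P := by
    rintro hu ⟨⟨x₀, -, hx₀⟩, hS⟩
    refine exists_lt_expectedUtility_of_bddAbove hu hx₀ ?_
    have hS' : ∀ᵐ ω ∂P, ¬ S.payoff.1 ω = 0 := by simpa [ae_iff] using hS
    filter_upwards [OrliczHeart.coeFn_nonneg S.payoff_nonneg, hS'] with ω h1 h2
    exact lt_of_le_of_ne h1 (Ne.symm h2)
  have hconv : BddAbove (Set.range u) →
      FinitelyValued (riskMeasure (shortfallAcceptanceSet P u α) S) →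
      (∃ x₀ : ℝ, 0 < x₀ ∧ α < u x₀) ∧ P {ω | S.payoff.1 ω = 0} = 0 := by
    intro hu hfin
    have hno : ¬ ∃ X : OrliczHeart u.hat P,
        ∀ t : ℝ, ∫ ω, u ((X + t • S.payoff).1 ω) ∂P < α := by
      rintro ⟨X, hX⟩
      obtain ⟨t, ht⟩ := (riskMeasure_ne_top_iff _ _ _).1 (hfin X).1
      exact (hX t).not_ge ht
    constructor
    · by_contra! hcon
      refine hno (exists_expectedUtility_lt_of_le hP (fun x => ?_) S.payoff_nonneg)
      -- The negated condition bounds `u` only at positive points; monotonicity carries the bound to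
      -- every `x`.
      exact (u.monotone' (le_max_left x 1)).trans (hcon _ (by positivity))
    · by_contra hS
      exact hno (exists_expectedUtility_lt_of_payoff_zero hu hS α)
  exact ⟨fun hu => ⟨⟨hconv hu, fun h => (hslack (hbdd hu h)).1⟩,
    fun h => (hslack (hbdd hu (hconv hu h))).2⟩,
    fun hu => hslack fun X => exists_lt_expectedUtility_of_not_bddAbove hu S.payoff_nonneg
      S.payoff_ne_zero X α⟩
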